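/- Let $(\mathbb X,d_{\mathbb X})$ and $(\mathbb U,d_{\mathbb U})$ be complete separable metric spaces with $\mathbb U$ compact, $\mathbb W$ a measurable space, and $\mu,\nu$ probability measures on $\mathbb W$. Let $c:\mathbb X\times\mathbb U\to[0,\infty)$ be bounded and continuous, and let $f:\mathbb X\times\mathbb U\times\mathbb W\to\mathbb X$ be measurable and such that $f(\cdot,\cdot,w)$ is continuous for each $w$. For the system $X_{t+1}=f(X_t,U_t,W_t)$ with i.i.d. noise of law $\mu$ (resp. $\nu$), write $\mathcal T_\mu(A\mid x,u)=\mu\{w: f(x,u,w)\in A\}$ (resp. $\mathcal T_\nu$) for its controlled transition kernel. For a kernel $\mathcal T$ and an admissible (history-dependent, randomized) policy $\gamma$ let $$J_\beta(c,\mathcal T,\gamma)(x)=\mathbb E^{\mathcal T,\gamma}\Big[\sum_{t\ge0}\beta^t c(X_t,U_t)\,\Big|\,X_0=x\Big],\qquad J_\infty(c,\mathcal T,\gamma)(x)=\limsup_{N\to\infty}\frac1N\,\mathbb E^{\mathcal T,\gamma}\Big[\sum_{t<N}c(X_t,U_t)\,\Big|\,X_0=x\Big],$$ and let $J^*_\beta(c,\mathcal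 T)$, $J^*_\infty(c,\mathcal T)$ be the infima over all admissible policies. For $g:\mathbb X\to\mathbb R$ put $$d_{g\circ f}(\mu,\nu)=\sup_{x\in\mathbb X,\,u\in\mathbb U}\Big|\int g(f(x,u,w))\,\mu(dw)-\int g(f(x,u,w))\,\nu(dw)\Big| .$$ **(Discounted cost.)** Let $\beta\in(0,1)$ and let $\gamma^*_{\nu,\beta}:\mathbb X\to\mathbb U$ be a measurable deterministic stationary policy that is optimal under $\nu$, i.e. $J_\beta(c,\mathcal T_\nu,\gamma^*_{\nu,\beta})=J^*_\beta(c,\mathcal T_\nu)$ on $\mathbb X$. Then $$\big\|J_\beta(c,\mathcal T_\mu,\gamma^*_{\nu,\beta})-J^*_\beta(c,\mathcal T_\mu)\big\|_\infty\le\frac{2\beta}{1-\beta}\,d_{J^*_\beta(c,\mathcal T_\nu)\circ f}(\mu,\nu),$$ and also $$\big\|J_\beta(c,\mathcal T_\mu,\gamma^*_{\nu,\beta})-J^*_\beta(c,\mathcal T_\mu)\big\|_\infty\le\frac{2\beta}{(1-\beta)^2}\,d_{J^*_\beta(c,\mathcal T_\mu)\circ f}(\mu,\nu).$$ **(Average cost.)**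 Assume in addition that $\mathbb X$ is compact, that $c$ is Lipschitz in $x$ uniformly in $u$, that $f$ is Lipschitz in $(x,u)$ uniformly in $w$, and that $f$ is Lipschitz in $x$, uniformly in $(u,w)$, with a constant $\|f\|_{\mathrm{Lip}(\mathbb X)}<1$. For $\lambda\in\{\mu,\nu\}$ let $h_\lambda$ be a relative value function obtained by vanishing discounting, i.e. for some $z\in\mathbb X$ and some increasing sequence $\beta_n\to1$ in $(0,1)$, $h_\lambda(x)=\lim_n\big(J^*_{\beta_n}(c,\mathcal T_\lambda)(x)-J^*_{\beta_n}(c,\mathcal T_\lambda)(z)\big)$ for all $x$. Let $\gamma^*_\nu:\mathbb X\to\mathbb U$ be the associated (canonical) average-cost optimal policy under $\nu$: a measurable map such that for each $x$ the action $\gamma^*_\nu(x)$ attains the infimum in the average cost optimality equation $g+h_\nu(x)=\inf_{u}\{c(x,u)+\int h_\nu(y)\,\mathcal T_\nu(dy\mid x,u)\}$. Suppose that for each $x$ there is an increasing sequence $\beta_n(x)\to1$ in $(0,1)$ with $(1-\beta_n(x))\,J_{\beta_n(x)}(c,\mathcal T_\mu,\gamma^*_\nu)(x)\to J_\infty(c,\mathcal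 T_\mu,\gamma^*_\nu)(x)$. Then, with $\tilde h_\lambda=h_\lambda\circ f$, $$\big\|J_\infty(c,\mathcal T_\mu,\gamma^*_\nu)-J^*_\infty(c,\mathcal T_\mu)\big\|_\infty\le d_{\tilde h_\mu}(\mu,\nu)+d_{\tilde h_\nu}(\mu,\nu).$$ -/

import Mathlib

open MeasureTheory ProbabilityTheory Filter Topology
open scoped ENNReal NNReal

namespace MDP

/-- Histories at time `t`: the past state-action pairs `(x_0,u_0), …, (x_{t-1},u_{t-1})` and the
current state `x_t`. -/
abbrev History (X U : Type*) (t : ℕ) : Type _ := (Fin t → X × U) × X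

/-- Admissible (history-dependent, randomized) policies: at each time a measurable map from
histories to probability measures on the action space. -/
structure Policy (X U : Type*) [MeasurableSpace X] [MeasurableSpace U] where
  kernel : (t : ℕ) → Kernel (History X U t) U
  markov : ∀ t, IsMarkovKernel (kernel t)

attribute [instance] Policy.markov

section ControlledChain

variable {X U : Type*} [MeasurableSpace X] [MeasurableSpace U]

/-- The deterministic stationary policy `u_t = γ(x_t)`. -/
noncomputable def stationary (γ : X → U) (hγ : Measurable γ) : Policy X U where
  kernel _ := Kernel.deterministic (fun h => γ h.2) (hγ.comp measurable_snd)
  markov _ := inferInstance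

/-- The history at time `n + 1`, from the state-action pairs up to time `n` and the new state. -/
def toHistory (n : ℕ) (p : (Finset.Iic n → X × U) × X) : History X U (n + 1) :=
  (fun i => p.1 ⟨i, Finset.mem_Iic.2 (Nat.lt_succ_iff.1 i.2)⟩, p.2)

lemma measurable_toHistory (n : ℕ) :
    Measurable (toHistory n : (Finset.Iic n → X × U) × X → History X U (n + 1)) := by
  unfold toHistory
  fun_prop

/-- The last state-action pair `(x_n, u_n)`. -/
def lastPair (n : ℕ) (a : Finset.Iic n → X × U) : X × U := a ⟨n, Finset.mem_Iic.2 le_rfl⟩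

lemma measurable_lastPair (n : ℕ) :
    Measurable (lastPair n : (Finset.Iic n → X × U) → X × U) := by
  unfold lastPair
  fun_prop

/-- Conditional law of `(x_{n+1}, u_{n+1})` given the past: `x_{n+1} ∼ T(· | x_n, u_n)`, then
`u_{n+1} ∼ γ_{n+1}(· | history)`. -/
noncomputable def stepKernel (T : Kernel (X × U) X) (π : Policy X U) (n : ℕ) :
    Kernel (Finset.Iic n → X × U) (X × U) :=
  (T.comap (lastPair n) (measurable_lastPair n)) ⊗ₖ
    ((π.kernel (n + 1)).comap (toHistory n) (measurable_toHistory n))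

instance (T : Kernel (X × U) X) [IsMarkovKernel T] (π : Policy X U) (n : ℕ) :
    IsMarkovKernel (stepKernel T π n) := by
  unfold stepKernel
  infer_instance

/-- Law of `(x_0, u_0)` when `x_0 = x`. -/
noncomputable def initialLaw (π : Policy X U) (x : X) : Measure (X × U) :=
  (π.kernel 0 (Fin.elim0, x)).map (fun u => (x, u))

/-- Law of the whole controlled process `((x_t, u_t))_t` under the transition kernel `T` and the
policy `π`, started at `x_0 = x`. -/
noncomputable def pathLaw (T : Kernel (X × U) X) [IsMarkovKernel T] (π : Policy X U) (x : X) :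
    Measure (ℕ → X × U) :=
  Kernel.trajMeasure (X := fun _ => X × U) (initialLaw π x) (stepKernel T π)

/-- The discounted cost `J_β(c, T, π)(x) = E[∑ β^t c(X_t, U_t) | X_0 = x]`. -/
noncomputable def discCost (β : ℝ) (c : X → U → ℝ) (T : Kernel (X × U) X) [IsMarkovKernel T]
    (π : Policy X U) (x : X) : ℝ :=
  ∫ ω, ∑' t : ℕ, β ^ t * c (ω t).1 (ω t).2 ∂(pathLaw T π x)

/-- The optimal discounted cost `J_β^*(c, T)(x)`. -/
noncomputable def discValue (β : ℝ) (c : X → U → ℝ) (T : Kernel (X × U) X) [IsMarkovKernel T]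
    (x : X) : ℝ :=
  ⨅ π : Policy X U, discCost β c T π x

/-- The average cost `J_∞(c, T, π)(x) = limsup_N (1/N) E[∑_{t<N} c(X_t, U_t) | X_0 = x]`. -/
noncomputable def avgCost (c : X → U → ℝ) (T : Kernel (X × U) X) [IsMarkovKernel T]
    (π : Policy X U) (x : X) : ℝ :=
  limsup (fun N : ℕ => (1 / (N : ℝ)) *
    ∫ ω, ∑ t ∈ Finset.range N, c (ω t).1 (ω t).2 ∂(pathLaw T π x)) atTop

/-- The optimal average cost `J_∞^*(c, T)(x)`. -/
noncomputable def avgValue (c : X → U → ℝ) (T : Kernel (X × U) X) [IsMarkovKernel T]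
    (x : X) : ℝ :=
  ⨅ π : Policy X U, avgCost c T π x

/-- `h` is a relative value function obtained from vanishing discounting: along some
`β_n ↑ 1` in `(0,1)` and for some base state `z`,
`J_{β_n}^*(c,T)(x) - J_{β_n}^*(c,T)(z) → h(x)` for all `x`. -/
def IsVanishingDiscountLimit (c : X → U → ℝ) (T : Kernel (X × U) X) [IsMarkovKernel T]
    (h : X → ℝ) : Prop :=
  ∃ (z : X) (b : ℕ → ℝ), Monotone b ∧ (∀ n, b n ∈ Set.Ioo (0 : ℝ) 1) ∧ Tendsto b atTop (𝓝 1) ∧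
    ∀ x, Tendsto (fun n => discValue (b n) c T x - discValue (b n) c T z) atTop (𝓝 (h x))

/-- `γ(x)` attains, for every `x`, the infimum over actions in the average cost optimality equation
`g + h(x) = inf_u {c(x,u) + ∫ h(y) T(dy | x, u)}`. -/
def AttainsACOE (c : X → U → ℝ) (T : Kernel (X × U) X) (h : X → ℝ) (γ : X → U) : Prop :=
  ∀ x u, c x (γ x) + ∫ y, h y ∂(T (x, γ x)) ≤ c x u + ∫ y, h y ∂(T (x, u))

/-- Vanishing-discount condition for a policy: for each `x` there are `β_n(x) ↑ 1` in `(0,1)` with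
`(1 - β_n(x)) J_{β_n(x)}(c,T,π)(x) → J_∞(c,T,π)(x)`. -/
def VanishingDiscountCondition (c : X → U → ℝ) (T : Kernel (X × U) X) [IsMarkovKernel T]
    (π : Policy X U) : Prop :=
  ∀ x, ∃ b : ℕ → ℝ, Monotone b ∧ (∀ n, b n ∈ Set.Ioo (0 : ℝ) 1) ∧ Tendsto b atTop (𝓝 1) ∧
    Tendsto (fun n => (1 - b n) * discCost (b n) c T π x) atTop (𝓝 (avgCost c T π x))

variable {W : Type*} [MeasurableSpace W]

/-- The controlled transition kernel `T_μ(A | x, u) = μ {w | f(x,u,w) ∈ A}` of the system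
`X_{t+1} = f(X_t, U_t, W_t)` with i.i.d. noise of law `μ`. -/
noncomputable def noiseKernel (f : X → U → W → X)
    (hf : Measurable fun p : (X × U) × W => f p.1.1 p.1.2 p.2) (μ : Measure W) [SFinite μ] :
    Kernel (X × U) X where
  toFun p := μ.map (fun w => f p.1 p.2 w)
  measurable' := by
    refine Measure.measurable_of_measurable_coe _ fun s hs => ?_
    have h1 : ∀ p : X × U, Measurable fun w => f p.1 p.2 w := fun p =>
      hf.comp (measurable_const.prodMk measurable_id : Measurable fun w : W => (p, w))
    simp_rw [fun p => Measure.map_apply (μ := μ) (h1 p) hs]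
    exact measurable_measure_prodMk_left (hf hs)

instance (f : X → U → W → X) (hf : Measurable fun p : (X × U) × W => f p.1.1 p.1.2 p.2)
    (μ : Measure W) [IsProbabilityMeasure μ] : IsMarkovKernel (noiseKernel f hf μ) where
  isProbabilityMeasure p := Measure.isProbabilityMeasure_map
    (hf.comp (measurable_const.prodMk measurable_id : Measurable fun w : W => (p, w))).aemeasurable

end ControlledChain

/-- The supremum norm `‖g‖_∞`, as an extended nonnegative real. -/
noncomputable def supNorm {X : Type*} (g : X → ℝ) : ℝ≥0∞ := ⨆ x, ENNReal.ofReal |g x|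

/-- The uniform discrepancy
`d_{g∘f}(μ,ν) = sup_{x,u} |∫ g(f(x,u,w)) μ(dw) - ∫ g(f(x,u,w)) ν(dw)|`. -/
noncomputable def noiseDisc {X U W : Type*} [MeasurableSpace W] (g : X → ℝ) (f : X → U → W → X)
    (μ ν : Measure W) : ℝ≥0∞ :=
  ⨆ (x : X) (u : U), ENNReal.ofReal |(∫ w, g (f x u w) ∂μ) - ∫ w, g (f x u w) ∂ν|

end MDP

/-! Everything rests on one telescoping identity. For bounded measurable `V`, let `G(x,u) = c(x,u) +
β ∫ V dT(·|x,u) - V(x)` be its Bellman defect. For every policy, `J_β(π)(x) - V(x)` is the expected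
sum of `β^t G(X_t,U_t)` (`hasSum_bellmanGap`), so a bound `a` on `G` along trajectories bounds this
difference by `a/(1-β)`. With `β = 1`, the average cost over `N` steps equals the average defect up
to `2B/N`, where `|V| ≤ B`. Replacing `μ` by `ν` changes `G` by at most `β d_{V∘f}(μ,ν)`
(`abs_bellmanGap_sub_le`).

Discounted cost. Contraction and verification identify `J*` with a bounded continuous solution of
the Bellman equation. For `V = J*_ν`, the defect under `ν` is nonnegative, and zero on the graph of
an optimal `γ`. Under `μ` it is at least `-βD` everywhere and at most `βD` on the graph; each side
costs `βD/(1-β)`. For `V = J*_μ`, the same comparison gives `‖J*_μ - J*_ν‖ ≤ e = βD/(1-β)`, and then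
the defect under `μ` on the graph of `γ` is at most `e + βD + βe = 2e`.

Average cost. As `f` contracts in `x`, discounted values are Lipschitz uniformly in `β`; compactness
then yields the optimality equation for `h_λ` with a constant `g_λ`. Verification with `β = 1` gives
`J_∞(μ,γ) ≤ g_ν + d_{h_ν∘f}`, `g_μ ≤ J*_∞(μ)` and `g_ν ≤ g_μ + d_{h_μ∘f}`, which add up to the
claim. -/

open scoped BoundedContinuousFunction

namespace MDP

/-! ### One-time marginals of the controlled process. -/

section Marginals

variable {X U : Type*} [MeasurableSpace X] [MeasurableSpace U]

instance (π : Policy X U) (x : X) : IsProbabilityMeasure (initialLaw π x) :=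
  Measure.isProbabilityMeasure_map (by fun_prop)

instance (T : Kernel (X × U) X) [IsMarkovKernel T] (π : Policy X U) (x : X) :
    IsProbabilityMeasure (pathLaw T π x) := by
  unfold pathLaw
  infer_instance

/-- The law of `(x_t, u_t)`. -/
noncomputable def marginal (T : Kernel (X × U) X) [IsMarkovKernel T] (π : Policy X U) (x : X)
    (t : ℕ) : Measure (X × U) :=
  (pathLaw T π x).map fun ω => ω t

variable (T : Kernel (X × U) X) [IsMarkovKernel T] (π : Policy X U) (x : X)

instance (t : ℕ) : IsProbabilityMeasure (marginal T π x t) :=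
  Measure.isProbabilityMeasure_map (measurable_pi_apply t).aemeasurable

lemma marginal_zero : marginal T π x 0 = initialLaw π x := by
  have h : (fun ω : ℕ → X × U => ω 0) =
      (fun a : Finset.Iic 0 → X × U => a ⟨0, by simp⟩) ∘ Preorder.frestrictLe 0 := rfl
  rw [marginal, h, ← Measure.map_map (by fun_prop) (by fun_prop), pathLaw, Kernel.trajMeasure,
    Measure.map_comp _ _ (by fun_prop), Kernel.traj_map_frestrictLe, Kernel.partialTraj_self,
    Measure.id_comp, Measure.map_map (by fun_prop) (by fun_prop)]
  exact Measure.map_id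

/-- Second marginal of the disintegration of the trajectory law at time `n`. The whole past is kept
because the next action may depend on it. -/
lemma marginal_succ_eq_comp (n : ℕ) :
    marginal T π x (n + 1) =
      stepKernel T π n ∘ₘ (pathLaw T π x).map (Preorder.frestrictLe n) := by
  have h := Kernel.map_frestrictLe_trajMeasure_compProd_eq_map_trajMeasure
    (X := fun _ => X × U) (μ₀ := initialLaw π x) (κ := stepKernel T π) (a := n)
  have h2 := congrArg Measure.snd h
  rw [Measure.snd_compProd] at h2
  refine Eq.trans ?_ h2.symm
  rw [Measure.snd, Measure.map_map (by fun_prop) (by fun_prop)]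
  rfl

/-- Controlled Markov property: the policy factor of `stepKernel` disappears on projecting to the
state, and the remaining factor sees only the last pair. Histories play no role in the telescoping
argument after this. -/
lemma fst_marginal_succ (n : ℕ) :
    (marginal T π x (n + 1)).fst = T ∘ₘ marginal T π x n := by
  have h : (fun ω : ℕ → X × U => ω n) = lastPair n ∘ Preorder.frestrictLe n := rfl
  rw [marginal_succ_eq_comp, Measure.fst, Measure.map_comp _ _ measurable_fst, ← Kernel.fst_eq,
    stepKernel, Kernel.fst_compProd, marginal, h,
    ← Measure.map_map (measurable_lastPair n) (by fun_prop)]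
  rw [← Measure.deterministic_comp_eq_map (measurable_lastPair n), Measure.comp_assoc,
    Kernel.comp_deterministic_eq_comap]

lemma integral_marginal_succ (n : ℕ) {h : X → ℝ} (hm : Measurable h) {B : ℝ}
    (hB : ∀ y, |h y| ≤ B) :
    ∫ p, h p.1 ∂(marginal T π x (n + 1)) = ∫ p, ∫ y, h y ∂(T p) ∂(marginal T π x n) := by
  have h1 : ∫ p, h p.1 ∂(marginal T π x (n + 1)) = ∫ y, h y ∂(marginal T π x (n + 1)).fst := by
    rw [Measure.fst, integral_map (by fun_prop) hm.aestronglyMeasurable]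
  rw [h1, fst_marginal_succ, ← Measure.snd_compProd, Measure.snd,
    integral_map (by fun_prop) hm.aestronglyMeasurable, Measure.integral_compProd]
  exact Integrable.of_bound (hm.comp measurable_snd).aestronglyMeasurable B
    (ae_of_all _ fun p => hB p.2)

lemma integral_marginal_zero {h : X → ℝ} (hm : Measurable h) :
    ∫ p, h p.1 ∂(marginal T π x 0) = h x := by
  rw [marginal_zero, initialLaw, integral_map (by fun_prop)
    (by exact (hm.comp measurable_fst).aestronglyMeasurable)]
  simp

lemma marginal_stationary_ae {γ : X → U} (hγ : Measurable γ)
    (hs : MeasurableSet {p : X × U | p.2 = γ p.1}) (t : ℕ) :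
    ∀ᵐ p ∂(marginal T (stationary γ hγ) x t), p.2 = γ p.1 := by
  cases t with
  | zero =>
    rw [marginal_zero, initialLaw, ae_map_iff (by fun_prop) hs]
    have : (stationary γ hγ).kernel 0 (Fin.elim0, x) = Measure.dirac (γ x) :=
      Kernel.deterministic_apply (hγ.comp measurable_snd) _
    rw [this, ae_dirac_iff]
    exact hs.preimage measurable_prodMk_left
  | succ n =>
    rw [marginal_succ_eq_comp]
    refine Measure.ae_comp_of_ae_ae hs (ae_of_all _ fun a => ?_)
    rw [stepKernel, Kernel.ae_compProd_iff hs]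
    refine ae_of_all _ fun y => ?_
    have : (((stationary γ hγ).kernel (n + 1)).comap (toHistory n) (measurable_toHistory n)) (a, y)
        = Measure.dirac (γ y) := by
      rw [Kernel.comap_apply]
      exact Kernel.deterministic_apply (hγ.comp measurable_snd) _
    rw [this, ae_dirac_iff]
    exact hs.preimage measurable_prodMk_left

end Marginals

/-! ### Verification: costs of policies in terms of Bellman defects. -/

section Verification

lemma tendsto_add_div_nat (g B : ℝ) : Tendsto (fun N : ℕ => g + B / (N : ℝ)) atTop (𝓝 g) := by
  simpa using (tendsto_const_nhds (x := g)).add (tendsto_const_div_atTop_nhds_zero_nat B)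

variable {X U : Type*} [MeasurableSpace X] [MeasurableSpace U]

/-- The defect of `V` in the Bellman equation with discount factor `β`. -/
noncomputable def bellmanGap (β : ℝ) (c : X → U → ℝ) (T : Kernel (X × U) X) (V : X → ℝ)
    (p : X × U) : ℝ :=
  c p.1 p.2 + β * ∫ y, V y ∂(T p) - V p.1

lemma measurable_bellmanGap {β : ℝ} {c : X → U → ℝ} {T : Kernel (X × U) X} [IsSFiniteKernel T]
    {V : X → ℝ} (hc : Measurable fun p : X × U => c p.1 p.2) (hV : Measurable V) :
    Measurable (bellmanGap β c T V) := by
  have h : Measurable fun p => ∫ y, V y ∂(T p) :=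
    (hV.stronglyMeasurable.integral_kernel (κ := T)).measurable
  exact (hc.add (h.const_mul β)).sub (hV.comp measurable_fst)

variable {β : ℝ} {c : X → U → ℝ} {T : Kernel (X × U) X} [IsMarkovKernel T] {V : X → ℝ} {M B : ℝ}

lemma abs_integral_le_of_abs_le {α : Type*} [MeasurableSpace α] (m : Measure α)
    [IsProbabilityMeasure m] {g : α → ℝ} {B : ℝ} (hB : ∀ y, |g y| ≤ B) : |∫ y, g y ∂m| ≤ B := by
  have := norm_integral_le_of_norm_le_const (μ := m) (f := g) (C := B) (ae_of_all _ hB)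
  simpa using this

lemma integrable_of_abs_le {α : Type*} [MeasurableSpace α] (m : Measure α)
    [IsFiniteMeasure m] {g : α → ℝ} (hg : Measurable g) {B : ℝ} (hB : ∀ y, |g y| ≤ B) :
    Integrable g m :=
  Integrable.of_bound hg.aestronglyMeasurable B (ae_of_all _ hB)

lemma abs_bellmanGap_le (hcM : ∀ x u, |c x u| ≤ M) (hVB : ∀ x, |V x| ≤ B) (p : X × U) :
    |bellmanGap β c T V p| ≤ M + |β| * B + B := by
  have h := abs_integral_le_of_abs_le (T p) hVB
  have h1 : |β * ∫ y, V y ∂(T p)| ≤ |β| * B := by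
    rw [abs_mul]
    exact mul_le_mul_of_nonneg_left h (abs_nonneg _)
  unfold bellmanGap
  exact (abs_sub _ _).trans (add_le_add ((abs_add_le _ _).trans
    (add_le_add (hcM _ _) h1)) (hVB _))

lemma integral_bellmanGap (hc : Measurable fun p : X × U => c p.1 p.2)
    (hcM : ∀ x u, |c x u| ≤ M) (hV : Measurable V) (hVB : ∀ x, |V x| ≤ B)
    (π : Policy X U) (x : X) (t : ℕ) :
    ∫ p, bellmanGap β c T V p ∂(marginal T π x t) =
      ∫ p, c p.1 p.2 ∂(marginal T π x t) + β * ∫ p, V p.1 ∂(marginal T π x (t + 1)) -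
        ∫ p, V p.1 ∂(marginal T π x t) := by
  have h : Measurable fun p => ∫ y, V y ∂(T p) :=
    (hV.stronglyMeasurable.integral_kernel (κ := T)).measurable
  have i1 := integrable_of_abs_le (marginal T π x t) hc fun p => hcM p.1 p.2
  have i2 := (integrable_of_abs_le (marginal T π x t) h
    fun p => abs_integral_le_of_abs_le (T p) hVB).const_mul β
  have i3 := integrable_of_abs_le (marginal T π x t) (hV.comp measurable_fst) fun p => hVB p.1
  rw [integral_marginal_succ T π x t hV hVB, ← integral_const_mul, ← integral_add i1 i2]
  exact integral_sub (i1.add i2) i3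

lemma integral_pathLaw_eq (hc : Measurable fun p : X × U => c p.1 p.2) (π : Policy X U) (x : X)
    (t : ℕ) :
    ∫ ω, c (ω t).1 (ω t).2 ∂(pathLaw T π x) = ∫ p, c p.1 p.2 ∂(marginal T π x t) := by
  rw [marginal, integral_map (measurable_pi_apply t).aemeasurable hc.aestronglyMeasurable]

lemma hasSum_discCost (hβ : β ∈ Set.Ioo (0 : ℝ) 1) (hc : Measurable fun p : X × U => c p.1 p.2)
    (hcM : ∀ x u, |c x u| ≤ M) (π : Policy X U) (x : X) :
    HasSum (fun t => β ^ t * ∫ p, c p.1 p.2 ∂(marginal T π x t)) (discCost β c T π x) := by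
  have hm : ∀ t : ℕ, Measurable fun ω : ℕ → X × U => c (ω t).1 (ω t).2 := fun t =>
    hc.comp (measurable_pi_apply t)
  have hi : ∀ t : ℕ, Integrable (fun ω : ℕ → X × U => c (ω t).1 (ω t).2) (pathLaw T π x) :=
    fun t => integrable_of_abs_le _ (hm t) fun ω => hcM _ _
  have h := hasSum_integral_of_summable_integral_norm (μ := pathLaw T π x)
    (F := fun (t : ℕ) (ω : ℕ → X × U) => β ^ t * c (ω t).1 (ω t).2)
    (fun t => (hi t).const_mul _) ?_
  · simp_rw [integral_const_mul, integral_pathLaw_eq hc] at h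
    exact h
  · refine Summable.of_nonneg_of_le (fun t => integral_nonneg fun ω => norm_nonneg _)
      (fun t => ?_) ((summable_geometric_of_lt_one hβ.1.le hβ.2).mul_right M)
    have hb : ∀ ω : ℕ → X × U, |‖β ^ t * c (ω t).1 (ω t).2‖| ≤ β ^ t * M := fun ω => by
      rw [Real.norm_eq_abs, abs_abs, abs_mul, abs_of_pos (pow_pos hβ.1 t)]
      exact mul_le_mul_of_nonneg_left (hcM _ _) (pow_pos hβ.1 t).le
    exact (le_abs_self _).trans (abs_integral_le_of_abs_le _ hb)

/-- The discounted cost of a policy exceeds `V` by the expected discounted sum of the Bellman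
defects of `V` along the trajectory. -/
lemma hasSum_bellmanGap (hβ : β ∈ Set.Ioo (0 : ℝ) 1)
    (hc : Measurable fun p : X × U => c p.1 p.2)
    (hcM : ∀ x u, |c x u| ≤ M) (hV : Measurable V) (hVB : ∀ x, |V x| ≤ B)
    (π : Policy X U) (x : X) :
    HasSum (fun t => β ^ t * ∫ p, bellmanGap β c T V p ∂(marginal T π x t))
      (discCost β c T π x - V x) := by
  set a : ℕ → ℝ := fun t => β ^ t * ∫ p, V p.1 ∂(marginal T π x t) with ha
  have hsum : Summable a := by
    refine Summable.of_norm_bounded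
      ((summable_geometric_of_lt_one hβ.1.le hβ.2).mul_right B) fun t => ?_
    rw [Real.norm_eq_abs, ha, abs_mul, abs_of_pos (pow_pos hβ.1 t)]
    exact mul_le_mul_of_nonneg_left
      (abs_integral_le_of_abs_le _ fun p : X × U => hVB p.1) (pow_pos hβ.1 t).le
  have h0 : a 0 = V x := by simp [ha, integral_marginal_zero T π x hV]
  have h1 : HasSum (fun t => a (t + 1)) (∑' t, a t - V x) := by
    have := (hasSum_nat_add_iff' 1).2 hsum.hasSum
    simpa [h0] using this
  have h2 := ((hasSum_discCost (T := T) hβ hc hcM π x).add h1).sub hsum.hasSum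
  rw [show discCost β c T π x + (∑' t, a t - V x) - ∑' t, a t = discCost β c T π x - V x by
    ring] at h2
  refine h2.congr_fun fun t => ?_
  rw [integral_bellmanGap hc hcM hV hVB, ha]
  ring

/-- The weights `β ^ t` sum to `1 / (1 - β)`. The bound is asked only almost everywhere, since for a
stationary policy the defect is controlled only on its graph. -/
lemma discCost_le (hβ : β ∈ Set.Ioo (0 : ℝ) 1)
    (hc : Measurable fun p : X × U => c p.1 p.2)
    (hcM : ∀ x u, |c x u| ≤ M) (hV : Measurable V) (hVB : ∀ x, |V x| ≤ B)
    (π : Policy X U) (x : X) {a : ℝ}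
    (ha : ∀ t, ∀ᵐ p ∂(marginal T π x t), bellmanGap β c T V p ≤ a) :
    discCost β c T π x ≤ V x + a / (1 - β) := by
  have h := hasSum_le (fun t => ?_) (hasSum_bellmanGap (T := T) hβ hc hcM hV hVB π x)
    ((hasSum_geometric_of_lt_one hβ.1.le hβ.2).mul_right a)
  · rw [div_eq_inv_mul]
    linarith
  · refine mul_le_mul_of_nonneg_left ?_ (pow_pos hβ.1 t).le
    have i := integrable_of_abs_le (marginal T π x t) (measurable_bellmanGap (β := β) hc hV)
      (abs_bellmanGap_le (T := T) hcM hVB)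
    have := integral_mono_ae i (integrable_const a) (ha t)
    simpa using this

lemma le_discCost (hβ : β ∈ Set.Ioo (0 : ℝ) 1)
    (hc : Measurable fun p : X × U => c p.1 p.2)
    (hcM : ∀ x u, |c x u| ≤ M) (hV : Measurable V) (hVB : ∀ x, |V x| ≤ B)
    (π : Policy X U) (x : X) {a : ℝ}
    (ha : ∀ t, ∀ᵐ p ∂(marginal T π x t), a ≤ bellmanGap β c T V p) :
    V x + a / (1 - β) ≤ discCost β c T π x := by
  have h := hasSum_le (fun t => ?_) ((hasSum_geometric_of_lt_one hβ.1.le hβ.2).mul_right a)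
    (hasSum_bellmanGap (T := T) hβ hc hcM hV hVB π x)
  · rw [div_eq_inv_mul]
    linarith
  · refine mul_le_mul_of_nonneg_left ?_ (pow_pos hβ.1 t).le
    have i := integrable_of_abs_le (marginal T π x t) (measurable_bellmanGap (β := β) hc hV)
      (abs_bellmanGap_le (T := T) hcM hVB)
    have := integral_mono_ae (integrable_const a) i (ha t)
    simpa using this

lemma discValue_le_discCost (hβ : β ∈ Set.Ioo (0 : ℝ) 1)
    (hc : Measurable fun p : X × U => c p.1 p.2) (hcM : ∀ x u, |c x u| ≤ M)
    (π : Policy X U) (x : X) : discValue β c T x ≤ discCost β c T π x := by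
  -- The real infimum needs a lower bound; it comes from `V = 0`, whose defect is `c` itself.
  refine ciInf_le ⟨0 + -M / (1 - β), ?_⟩ π
  rintro _ ⟨π', rfl⟩
  refine le_discCost (V := fun _ => 0) (B := 0) hβ hc hcM measurable_const (by simp) π' x
    fun t => ae_of_all _ fun p => ?_
  simpa [bellmanGap] using (abs_le.1 (hcM p.1 p.2)).1

lemma le_discValue [Nonempty (Policy X U)] (hβ : β ∈ Set.Ioo (0 : ℝ) 1)
    (hc : Measurable fun p : X × U => c p.1 p.2)
    (hcM : ∀ x u, |c x u| ≤ M) (hV : Measurable V) (hVB : ∀ x, |V x| ≤ B) {a : ℝ}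
    (ha : ∀ p, a ≤ bellmanGap β c T V p) (x : X) : V x + a / (1 - β) ≤ discValue β c T x :=
  le_ciInf fun π => le_discCost hβ hc hcM hV hVB π x fun _ => ae_of_all _ ha

lemma abs_discValue_le [Nonempty (Policy X U)] (hβ : β ∈ Set.Ioo (0 : ℝ) 1)
    (hc : Measurable fun p : X × U => c p.1 p.2) (hcM : ∀ x u, |c x u| ≤ M) (x : X) :
    |discValue β c T x| ≤ M / (1 - β) := by
  have h : ∀ p, bellmanGap β c T (fun _ => 0) p = c p.1 p.2 := fun p => by simp [bellmanGap]
  rw [abs_le, ← neg_div]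
  constructor
  · simpa using le_discValue (T := T) (V := fun _ => 0) (B := 0) (a := -M) hβ hc hcM
      measurable_const (by simp) (fun p => by rw [h]; exact (abs_le.1 (hcM _ _)).1) x
  · have π : Policy X U := Classical.arbitrary _
    refine (discValue_le_discCost hβ hc hcM π x).trans ?_
    simpa using discCost_le (T := T) (V := fun _ => 0) (B := 0) (a := M) hβ hc hcM
      measurable_const (by simp) π x
      fun t => ae_of_all _ fun p => by rw [h]; exact (abs_le.1 (hcM _ _)).2

/-- A vanishing sum of nonnegative terms has a vanishing term at `t = 0`, and at that time the
process sits exactly at `(x, γ x)`. -/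
lemma bellmanGap_stationary_eq_zero (hβ : β ∈ Set.Ioo (0 : ℝ) 1)
    (hc : Measurable fun p : X × U => c p.1 p.2)
    (hcM : ∀ x u, |c x u| ≤ M) (hV : Measurable V) (hVB : ∀ x, |V x| ≤ B)
    (hgap : ∀ p, 0 ≤ bellmanGap β c T V p) {γ : X → U} (hγ : Measurable γ) (x : X)
    (h : discCost β c T (stationary γ hγ) x = V x) : bellmanGap β c T V (x, γ x) = 0 := by
  have hs := hasSum_bellmanGap (T := T) hβ hc hcM hV hVB (stationary γ hγ) x
  rw [h, sub_self, hasSum_zero_iff_of_nonneg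
    (fun t => mul_nonneg (pow_pos hβ.1 t).le (integral_nonneg hgap))] at hs
  have h0 := congrFun hs 0
  have hm := measurable_bellmanGap (T := T) (β := β) hc hV
  have : (stationary γ hγ).kernel 0 (Fin.elim0, x) = Measure.dirac (γ x) :=
    Kernel.deterministic_apply (hγ.comp measurable_snd) _
  simp only [pow_zero, one_mul, Pi.zero_apply] at h0
  rw [marginal_zero, initialLaw, integral_map (by fun_prop) hm.aestronglyMeasurable, this,
    integral_dirac' _ _ (by exact (hm.comp measurable_prodMk_left).stronglyMeasurable)] at h0
  exact h0

/-- Undiscounted telescoping: the boundary term is bounded uniformly in `N`, so it disappears after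
division by `N`. -/
lemma integral_sum_pathLaw (hc : Measurable fun p : X × U => c p.1 p.2)
    (hcM : ∀ x u, |c x u| ≤ M) (hV : Measurable V) (hVB : ∀ x, |V x| ≤ B)
    (π : Policy X U) (x : X) (N : ℕ) :
    ∫ ω, ∑ t ∈ Finset.range N, c (ω t).1 (ω t).2 ∂(pathLaw T π x) =
      ∑ t ∈ Finset.range N, ∫ p, bellmanGap 1 c T V p ∂(marginal T π x t) +
        (V x - ∫ p, V p.1 ∂(marginal T π x N)) := by
  have hi : ∀ t ∈ Finset.range N,
      Integrable (fun ω : ℕ → X × U => c (ω t).1 (ω t).2) (pathLaw T π x) := fun t _ =>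
    integrable_of_abs_le _ (hc.comp (measurable_pi_apply t)) fun ω => hcM _ _
  rw [integral_finsetSum _ hi]
  clear hi
  simp_rw [integral_pathLaw_eq hc]
  induction N with
  | zero => simp [integral_marginal_zero T π x hV]
  | succ N ih =>
    rw [Finset.sum_range_succ, Finset.sum_range_succ, ih, integral_bellmanGap hc hcM hV hVB]
    ring

lemma abs_average_le (hcM : ∀ x u, |c x u| ≤ M) (π : Policy X U) (x : X) (N : ℕ) :
    |(1 / (N : ℝ)) * ∫ ω, ∑ t ∈ Finset.range N, c (ω t).1 (ω t).2 ∂(pathLaw T π x)| ≤ M := by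
  -- Needed at `N = 0`, where `1 / 0 = 0` makes the average zero.
  have hM : 0 ≤ M := by
    obtain ⟨p⟩ := (marginal T π x 0).nonempty_of_neZero
    exact (abs_nonneg _).trans (hcM p.1 p.2)
  have h : |∫ ω, ∑ t ∈ Finset.range N, c (ω t).1 (ω t).2 ∂(pathLaw T π x)| ≤ N * M := by
    refine abs_integral_le_of_abs_le _ fun ω => (Finset.abs_sum_le_sum_abs _ _).trans ?_
    refine (Finset.sum_le_sum fun t _ => hcM _ _).trans ?_
    simp
  rw [abs_mul, abs_of_nonneg (by positivity)]
  refine (mul_le_mul_of_nonneg_left h (by positivity)).trans ?_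
  rcases Nat.eq_zero_or_pos N with rfl | hN
  · simpa using hM
  · have : (0 : ℝ) < N := by exact_mod_cast hN
    field_simp
    exact le_rfl

lemma isBoundedUnder_average (hcM : ∀ x u, |c x u| ≤ M) (π : Policy X U) (x : X) :
    IsBoundedUnder (· ≤ ·) atTop (fun N : ℕ => (1 / (N : ℝ)) *
      ∫ ω, ∑ t ∈ Finset.range N, c (ω t).1 (ω t).2 ∂(pathLaw T π x)) ∧
    IsBoundedUnder (· ≥ ·) atTop (fun N : ℕ => (1 / (N : ℝ)) *
      ∫ ω, ∑ t ∈ Finset.range N, c (ω t).1 (ω t).2 ∂(pathLaw T π x)) :=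
  ⟨isBoundedUnder_of ⟨M, fun N => (abs_le.1 (abs_average_le hcM π x N)).2⟩,
    isBoundedUnder_of ⟨-M, fun N => (abs_le.1 (abs_average_le hcM π x N)).1⟩⟩

lemma avgCost_le (hc : Measurable fun p : X × U => c p.1 p.2)
    (hcM : ∀ x u, |c x u| ≤ M) (hV : Measurable V) (hVB : ∀ x, |V x| ≤ B)
    (π : Policy X U) (x : X) {g : ℝ}
    (hg : ∀ t, ∀ᵐ p ∂(marginal T π x t), bellmanGap 1 c T V p ≤ g) :
    avgCost c T π x ≤ g := by
  have hlim := tendsto_add_div_nat g (2 * B)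
  refine (limsup_le_limsup ?_ (isBoundedUnder_average hcM π x).2.isCoboundedUnder_le
    hlim.isBoundedUnder_le).trans hlim.limsup_eq.le
  filter_upwards [eventually_gt_atTop 0] with N hN
  have hN' : (0 : ℝ) < N := by exact_mod_cast hN
  rw [integral_sum_pathLaw hc hcM hV hVB]
  have h1 : ∑ t ∈ Finset.range N, ∫ p, bellmanGap 1 c T V p ∂(marginal T π x t) ≤ N * g := by
    refine (Finset.sum_le_sum (g := fun _ => g) fun t _ => ?_).trans (by simp)
    have i := integrable_of_abs_le (marginal T π x t) (measurable_bellmanGap (β := 1) hc hV)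
      (abs_bellmanGap_le (T := T) hcM hVB)
    simpa using integral_mono_ae i (integrable_const g) (hg t)
  have h2 := (abs_le.1 (abs_integral_le_of_abs_le (marginal T π x N)
    fun p : X × U => hVB p.1)).1
  have h3 := (abs_le.1 (hVB x)).2
  rw [one_div, inv_mul_le_iff₀ hN', mul_add, mul_div_cancel₀ _ hN'.ne']
  linarith

lemma le_avgCost (hc : Measurable fun p : X × U => c p.1 p.2)
    (hcM : ∀ x u, |c x u| ≤ M) (hV : Measurable V) (hVB : ∀ x, |V x| ≤ B)
    (π : Policy X U) (x : X) {g : ℝ}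
    (hg : ∀ t, ∀ᵐ p ∂(marginal T π x t), g ≤ bellmanGap 1 c T V p) :
    g ≤ avgCost c T π x := by
  have hlim := tendsto_add_div_nat g (-(2 * B))
  refine hlim.limsup_eq.ge.trans (limsup_le_limsup ?_ hlim.isBoundedUnder_ge.isCoboundedUnder_le
    (isBoundedUnder_average hcM π x).1)
  filter_upwards [eventually_gt_atTop 0] with N hN
  have hN' : (0 : ℝ) < N := by exact_mod_cast hN
  rw [integral_sum_pathLaw hc hcM hV hVB]
  have h1 : N * g ≤ ∑ t ∈ Finset.range N, ∫ p, bellmanGap 1 c T V p ∂(marginal T π x t) := by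
    refine le_trans (by simp) (Finset.sum_le_sum (f := fun _ => g) fun t _ => ?_)
    have i := integrable_of_abs_le (marginal T π x t) (measurable_bellmanGap (β := 1) hc hV)
      (abs_bellmanGap_le (T := T) hcM hVB)
    simpa using integral_mono_ae (integrable_const g) i (hg t)
  have h2 := (abs_le.1 (abs_integral_le_of_abs_le (marginal T π x N)
    fun p : X × U => hVB p.1)).2
  have h3 := (abs_le.1 (hVB x)).1
  rw [one_div, le_inv_mul_iff₀ hN', mul_add, mul_div_cancel₀ _ hN'.ne']
  linarith

lemma avgValue_le_avgCost (hcM : ∀ x u, |c x u| ≤ M) (π : Policy X U) (x : X) :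
    avgValue c T x ≤ avgCost c T π x := by
  refine ciInf_le ⟨-M, ?_⟩ π
  rintro _ ⟨π', rfl⟩
  refine le_limsup_of_frequently_le (Frequently.of_forall fun N => ?_)
    (isBoundedUnder_average hcM π' x).1
  exact (abs_le.1 (abs_average_le hcM π' x N)).1

end Verification

/-! ### Measurable near-minimizers. -/

section Selection

variable {X U : Type*} [TopologicalSpace X] [MeasurableSpace X] [OpensMeasurableSpace X]
  [TopologicalSpace U] [TopologicalSpace.SeparableSpace U] [MeasurableSpace U]

/-- The strict inequality `g (x, ·) < a + ε` defines a nonempty open set, which a dense sequence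
must meet; the first index that enters it depends measurably on `x`. The loss `ε` replaces an exact
measurable selection theorem. -/
lemma exists_measurable_selector_le {g : X × U → ℝ} (hg : Continuous g) {a ε : ℝ} (hε : 0 < ε)
    (h : ∀ x, ∃ u, g (x, u) ≤ a) : ∃ γ : X → U, Measurable γ ∧ ∀ x, g (x, γ x) ≤ a + ε := by
  classical
  rcases isEmpty_or_nonempty X with hX | ⟨⟨x₀⟩⟩
  · exact ⟨fun x => hX.elim x, measurable_of_empty _, fun x => hX.elim x⟩
  have : Nonempty U := ⟨(h x₀).choose⟩
  have hex : ∀ x, ∃ n, g (x, TopologicalSpace.denseSeq U n) < a + ε := fun x => by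
    obtain ⟨u, hu⟩ := h x
    have ho : IsOpen {u | g (x, u) < a + ε} :=
      isOpen_lt (hg.comp (Continuous.prodMk_right x)) continuous_const
    obtain ⟨_, hv, n, rfl⟩ := (TopologicalSpace.denseRange_denseSeq U).inter_open_nonempty
      _ ho ⟨u, by simp only [Set.mem_ofPred_eq]; linarith⟩
    exact ⟨n, hv⟩
  refine ⟨fun x => TopologicalSpace.denseSeq U (Nat.find (hex x)),
    Measurable.find (f := fun n _ => TopologicalSpace.denseSeq U n)
      (p := fun n x => g (x, TopologicalSpace.denseSeq U n) < a + ε)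
      (fun n => measurable_const) (fun n => ?_) hex, fun x => (Nat.find_spec (hex x)).le⟩
  exact (isOpen_lt (hg.comp (Continuous.prodMk_left _)) continuous_const).measurableSet

end Selection

/-! ### Upper bounds on the optimal cost through stationary policies. -/

section Optimality

variable {X U : Type*} [MeasurableSpace X] [MeasurableSpace U] [MeasurableEq U]
  {β : ℝ} {c : X → U → ℝ} {T : Kernel (X × U) X} [IsMarkovKernel T] {V : X → ℝ} {M B : ℝ}

lemma stationary_ae_of_forall {γ : X → U} (hγ : Measurable γ) {P : X × U → Prop}
    (h : ∀ x, P (x, γ x)) (x : X) (t : ℕ) :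
    ∀ᵐ p ∂(marginal T (stationary γ hγ) x t), P p := by
  have hs : MeasurableSet {p : X × U | p.2 = γ p.1} :=
    measurableSet_eq_fun measurable_snd (hγ.comp measurable_fst)
  filter_upwards [marginal_stationary_ae T x hγ hs t] with p hp
  have : p = (p.1, γ p.1) := Prod.ext rfl hp
  rw [this]
  exact h p.1

lemma discValue_le (hβ : β ∈ Set.Ioo (0 : ℝ) 1)
    (hc : Measurable fun p : X × U => c p.1 p.2)
    (hcM : ∀ x u, |c x u| ≤ M) (hV : Measurable V) (hVB : ∀ x, |V x| ≤ B) {a : ℝ}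
    (hsel : ∀ ε > 0, ∃ γ : X → U, Measurable γ ∧ ∀ x, bellmanGap β c T V (x, γ x) ≤ a + ε)
    (x : X) : discValue β c T x ≤ V x + a / (1 - β) := by
  have h1β : 0 < 1 - β := sub_pos.2 hβ.2
  refine le_of_forall_pos_le_add fun ε hε => ?_
  -- A defect error of `ε * (1 - β)` costs `ε` after summation over time.
  obtain ⟨γ, hγ, h⟩ := hsel (ε * (1 - β)) (mul_pos hε h1β)
  refine (discValue_le_discCost hβ hc hcM (stationary γ hγ) x).trans ?_
  refine (discCost_le (T := T) hβ hc hcM hV hVB _ x (stationary_ae_of_forall hγ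
    (P := fun p => bellmanGap β c T V p ≤ a + ε * (1 - β)) h x)).trans ?_
  rw [add_div, mul_div_cancel_right₀ _ h1β.ne', add_assoc]

end Optimality

/-! ### Integrals against the noise-driven kernel. -/

section NoiseKernel

variable {X U W : Type*} [MeasurableSpace X] [MeasurableSpace U] [MeasurableSpace W]
  {f : X → U → W → X} (hf : Measurable fun p : (X × U) × W => f p.1.1 p.1.2 p.2)
  (μ : Measure W)

include hf in
lemma measurable_noise_section (x : X) (u : U) : Measurable fun w => f x u w :=
  hf.comp (measurable_const.prodMk measurable_id : Measurable fun w : W => ((x, u), w))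

lemma integral_noiseKernel [SFinite μ] {V : X → ℝ} (hV : Measurable V) (p : X × U) :
    ∫ y, V y ∂(noiseKernel f hf μ p) = ∫ w, V (f p.1 p.2 w) ∂μ :=
  integral_map (measurable_noise_section hf _ _).aemeasurable hV.aestronglyMeasurable

lemma bellmanGap_noiseKernel [SFinite μ] {β : ℝ} {c : X → U → ℝ} {V : X → ℝ} (hV : Measurable V)
    (p : X × U) : bellmanGap β c (noiseKernel f hf μ) V p =
      c p.1 p.2 + β * ∫ w, V (f p.1 p.2 w) ∂μ - V p.1 := by
  rw [bellmanGap, integral_noiseKernel hf μ hV]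

end NoiseKernel

section NoiseIntegral

variable {X U W : Type*} [MetricSpace X] [MeasurableSpace X] [BorelSpace X]
  [MeasurableSpace U] [MeasurableSpace W] (μ : Measure W) [IsProbabilityMeasure μ]
  {f : X → U → W → X} (hf : Measurable fun p : (X × U) × W => f p.1.1 p.1.2 p.2)

include hf in
lemma continuous_integral_noise [TopologicalSpace U] [FirstCountableTopology U]
    (hfc : ∀ w, Continuous fun p : X × U => f p.1 p.2 w) (v : X →ᵇ ℝ) :
    Continuous fun p : X × U => ∫ w, v (f p.1 p.2 w) ∂μ := by
  refine continuous_of_dominated (bound := fun _ => ‖v‖) (fun p => ?_) (fun p => ?_)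
    (integrable_const _) (ae_of_all _ fun w => v.continuous.comp (hfc w))
  · exact (v.continuous.measurable.comp (measurable_noise_section hf _ _)).aestronglyMeasurable
  · exact ae_of_all _ fun _ => v.norm_coe_le_norm _

include hf in
lemma continuous_bellman [TopologicalSpace U] [FirstCountableTopology U] {c : X → U → ℝ}
    (hc : Continuous fun p : X × U => c p.1 p.2)
    (hfc : ∀ w, Continuous fun p : X × U => f p.1 p.2 w) (β : ℝ) (v : X →ᵇ ℝ) :
    Continuous fun p : X × U => c p.1 p.2 + β * ∫ w, v (f p.1 p.2 w) ∂μ :=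
  hc.add ((continuous_integral_noise μ hf hfc v).const_mul β)

lemma continuous_bellmanGap [TopologicalSpace U] [FirstCountableTopology U] {c : X → U → ℝ}
    (hc : Continuous fun p : X × U => c p.1 p.2)
    (hfc : ∀ w, Continuous fun p : X × U => f p.1 p.2 w) (β : ℝ) (v : X →ᵇ ℝ) :
    Continuous (bellmanGap β c (noiseKernel f hf μ) v) := by
  refine Continuous.congr ?_
    fun p => (bellmanGap_noiseKernel hf μ v.continuous.measurable p).symm
  exact (continuous_bellman μ hf hc hfc β v).sub (v.continuous.comp continuous_fst)

include hf in
lemma integrable_noise (v : X →ᵇ ℝ) (x : X) (u : U) : Integrable (fun w => v (f x u w)) μ :=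
  integrable_of_abs_le μ (v.continuous.measurable.comp (measurable_noise_section hf x u))
    fun _ => v.norm_coe_le_norm _

include hf in
lemma abs_integral_noise_sub_le (v v' : X →ᵇ ℝ) (x : X) (u : U) :
    |(∫ w, v (f x u w) ∂μ) - ∫ w, v' (f x u w) ∂μ| ≤ dist v v' := by
  rw [← integral_sub (integrable_noise μ hf v x u) (integrable_noise μ hf v' x u)]
  exact abs_integral_le_of_abs_le μ fun _ => v.dist_coe_le_dist _

lemma abs_bellman_le {X U W : Type*} [TopologicalSpace X] [MeasurableSpace W] (μ : Measure W)
    [IsProbabilityMeasure μ] {c : X → U → ℝ} {M : ℝ} (hcM : ∀ x u, |c x u| ≤ M)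
    (f : X → U → W → X) (β : ℝ) (v : X →ᵇ ℝ) (x : X) (u : U) :
    |c x u + β * ∫ w, v (f x u w) ∂μ| ≤ M + |β| * ‖v‖ := by
  refine (abs_add_le _ _).trans (add_le_add (hcM x u) ?_)
  rw [abs_mul]
  exact mul_le_mul_of_nonneg_left
    (abs_integral_le_of_abs_le μ fun _ => v.norm_coe_le_norm _) (abs_nonneg _)

end NoiseIntegral

/-! ### The Bellman operator and its fixed point. -/

section Bellman

variable {X U W : Type*} [MetricSpace X] [MeasurableSpace X] [BorelSpace X]
  [MetricSpace U] [CompactSpace U] [MeasurableSpace U]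
  [MeasurableSpace W] (μ : Measure W) [IsProbabilityMeasure μ]
  {c : X → U → ℝ} {M : ℝ} (hcM : ∀ x u, |c x u| ≤ M)
  (hc : Continuous fun p : X × U => c p.1 p.2)
  {f : X → U → W → X} (hf : Measurable fun p : (X × U) × W => f p.1.1 p.1.2 p.2)
  (hfc : ∀ w, Continuous fun p : X × U => f p.1 p.2 w)

include hc hf hfc in
lemma exists_bellman_minimizer [Nonempty U] (β : ℝ) (v : X →ᵇ ℝ) (x : X) :
    ∃ u, (⨅ u, (c x u + β * ∫ w, v (f x u w) ∂μ)) = c x u + β * ∫ w, v (f x u w) ∂μ ∧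
      ∀ u', c x u + β * ∫ w, v (f x u w) ∂μ ≤ c x u' + β * ∫ w, v (f x u' w) ∂μ := by
  obtain ⟨u, -, h, h'⟩ := isCompact_univ.exists_sInf_image_eq_and_le Set.univ_nonempty
    ((continuous_bellman μ hf hc hfc β v).comp (Continuous.prodMk_right x)).continuousOn
  rw [Set.image_univ, sInf_range] at h
  exact ⟨u, h, fun u' => h' u' trivial⟩

/-- The Bellman operator on bounded continuous functions. -/
noncomputable def bellmanOp [Nonempty U] (β : ℝ) (v : X →ᵇ ℝ) : X →ᵇ ℝ :=
  BoundedContinuousFunction.ofNormedAddCommGroup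
    (fun x => ⨅ u, (c x u + β * ∫ w, v (f x u w) ∂μ))
    (by
      have := isCompact_univ.continuous_sInf (f := fun (x : X) (u : U) =>
        c x u + β * ∫ w, v (f x u w) ∂μ) (K := Set.univ) (continuous_bellman μ hf hc hfc β v)
      simpa only [Set.image_univ, sInf_range] using this)
    (M + |β| * ‖v‖)
    (fun x => by
      obtain ⟨u, h, -⟩ := exists_bellman_minimizer μ hc hf hfc β v x
      rw [h, Real.norm_eq_abs]
      exact abs_bellman_le μ hcM f β v x u)

lemma bellmanOp_apply [Nonempty U] (β : ℝ) (v : X →ᵇ ℝ) (x : X) :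
    bellmanOp μ hcM hc hf hfc β v x = ⨅ u, (c x u + β * ∫ w, v (f x u w) ∂μ) := rfl

/-- The minimizer for `v'` is a competitor in the minimization for `v`. -/
lemma bellmanOp_sub_le [Nonempty U] {β : ℝ} (hβ : 0 ≤ β) (v v' : X →ᵇ ℝ) (x : X) :
    bellmanOp μ hcM hc hf hfc β v x - bellmanOp μ hcM hc hf hfc β v' x ≤ β * dist v v' := by
  obtain ⟨u, h, hu⟩ := exists_bellman_minimizer μ hc hf hfc β v x
  obtain ⟨u', h', -⟩ := exists_bellman_minimizer μ hc hf hfc β v' x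
  rw [bellmanOp_apply, bellmanOp_apply, h, h']
  have h1 := mul_le_mul_of_nonneg_left
    (abs_le.1 (abs_integral_noise_sub_le μ hf v v' x u')).2 hβ
  have h2 := hu u'
  linarith

lemma contracting_bellmanOp [Nonempty U] {β : ℝ} (hβ : β ∈ Set.Ioo (0 : ℝ) 1) :
    ContractingWith ⟨β, hβ.1.le⟩ (bellmanOp μ hcM hc hf hfc β) := by
  refine ⟨hβ.2, LipschitzWith.of_dist_le_mul fun v v' => ?_⟩
  refine (BoundedContinuousFunction.dist_le (mul_nonneg hβ.1.le dist_nonneg)).2 fun x => ?_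
  rw [Real.dist_eq, abs_le]
  have h1 := bellmanOp_sub_le μ hcM hc hf hfc hβ.1.le v v' x
  have h2 := bellmanOp_sub_le μ hcM hc hf hfc hβ.1.le v' v x
  rw [dist_comm] at h2
  exact ⟨by change -(β * dist v v') ≤ _; linarith, h1⟩

include hcM hc hfc in
/-- The optimal discounted cost is a bounded continuous solution of the Bellman equation. -/
theorem exists_discValue_eq [SecondCountableTopology X] [BorelSpace U] [Nonempty U]
    {β : ℝ} (hβ : β ∈ Set.Ioo (0 : ℝ) 1) :
    ∃ v : X →ᵇ ℝ, (∀ x, discValue β c (noiseKernel f hf μ) x = v x) ∧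
      (∀ p, 0 ≤ bellmanGap β c (noiseKernel f hf μ) v p) ∧
      ∀ x, ∃ u, bellmanGap β c (noiseKernel f hf μ) v (x, u) = 0 := by
  obtain ⟨v, hv, -⟩ := (contracting_bellmanOp μ hcM hc hf hfc hβ).exists_fixedPoint 0
    (edist_ne_top _ _)
  have hvm := v.continuous.measurable
  have hgap : ∀ p, 0 ≤ bellmanGap β c (noiseKernel f hf μ) v p := fun p => by
    rw [bellmanGap_noiseKernel hf μ hvm, sub_nonneg]
    obtain ⟨u, h, hu⟩ := exists_bellman_minimizer μ hc hf hfc β v p.1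
    nth_rw 1 [← hv.eq]
    rw [bellmanOp_apply, h]
    exact hu p.2
  have hmin : ∀ x, ∃ u, bellmanGap β c (noiseKernel f hf μ) v (x, u) = 0 := fun x => by
    obtain ⟨u, h, hu⟩ := exists_bellman_minimizer μ hc hf hfc β v x
    refine ⟨u, ?_⟩
    rw [bellmanGap_noiseKernel hf μ hvm, sub_eq_zero]
    nth_rw 2 [← hv.eq]
    rw [bellmanOp_apply, h]
  have : Nonempty (Policy X U) :=
    ⟨stationary (fun _ => Classical.arbitrary U) measurable_const⟩
  -- Near-minimizing stationary policies give the upper bound; the nonnegative defect bounds every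
  -- history-dependent policy from below.
  refine ⟨v, fun x => le_antisymm ?_ ?_, hgap, hmin⟩
  · simpa using discValue_le (T := noiseKernel f hf μ) hβ hc.measurable hcM hvm
      (fun x => v.norm_coe_le_norm x) (a := 0) (fun ε hε => exists_measurable_selector_le
        (continuous_bellmanGap μ hf hc hfc β v) hε fun x => (hmin x).imp fun u hu => hu.le) x
  · simpa using le_discValue (T := noiseKernel f hf μ) hβ hc.measurable hcM hvm
      (fun x => v.norm_coe_le_norm x) hgap x

end Bellman

/-! ### Effect of a change of noise law on the defect. -/

section Discrepancy

lemma supNorm_le_iff {X : Type*} {g : X → ℝ} {a : ℝ≥0∞} :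
    supNorm g ≤ a ↔ ∀ x, ENNReal.ofReal |g x| ≤ a := iSup_le_iff

variable {X U W : Type*} [MeasurableSpace W] {μ ν : Measure W} [IsProbabilityMeasure μ]
  [IsProbabilityMeasure ν] {f : X → U → W → X} {V : X → ℝ} {B : ℝ}

/-- Finiteness is what makes `toReal` faithful, as it sends `∞` to `0`. -/
lemma noiseDisc_ne_top (hVB : ∀ x, |V x| ≤ B) : noiseDisc V f μ ν ≠ ∞ := by
  refine ne_top_of_le_ne_top (ENNReal.ofReal_ne_top (r := B + B)) ?_
  refine iSup₂_le fun x u => ENNReal.ofReal_le_ofReal ((abs_sub _ _).trans (add_le_add ?_ ?_)) <;>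
    exact abs_integral_le_of_abs_le _ fun _ => hVB _

lemma abs_integral_sub_le_noiseDisc (hVB : ∀ x, |V x| ≤ B) (x : X) (u : U) :
    |(∫ w, V (f x u w) ∂μ) - ∫ w, V (f x u w) ∂ν| ≤ (noiseDisc V f μ ν).toReal := by
  rw [← ENNReal.ofReal_le_iff_le_toReal (noiseDisc_ne_top hVB)]
  exact le_iSup₂_of_le (f := fun (x : X) (u : U) =>
    ENNReal.ofReal |(∫ w, V (f x u w) ∂μ) - ∫ w, V (f x u w) ∂ν|) x u le_rfl

/-- The terms `c` and `V` cancel; only the noise integral changes. -/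
lemma abs_bellmanGap_sub_le [MeasurableSpace X] [MeasurableSpace U]
    (hf : Measurable fun p : (X × U) × W => f p.1.1 p.1.2 p.2) {c : X → U → ℝ}
    (hV : Measurable V) (hVB : ∀ x, |V x| ≤ B) {β : ℝ} (hβ : 0 ≤ β) (p : X × U) :
    |bellmanGap β c (noiseKernel f hf μ) V p - bellmanGap β c (noiseKernel f hf ν) V p| ≤
      β * (noiseDisc V f μ ν).toReal := by
  rw [bellmanGap_noiseKernel hf μ hV, bellmanGap_noiseKernel hf ν hV]
  have h := mul_le_mul_of_nonneg_left
    (abs_integral_sub_le_noiseDisc (f := f) (μ := μ) (ν := ν) hVB p.1 p.2) hβ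
  rw [← abs_of_nonneg hβ, ← abs_mul, abs_of_nonneg hβ] at h
  refine le_of_eq_of_le (congrArg _ ?_) h
  ring

end Discrepancy

/-! ### The two discounted bounds. -/

section Discounted

variable {X U W : Type*} [MetricSpace X] [SecondCountableTopology X]
  [MeasurableSpace X] [BorelSpace X]
  [MetricSpace U] [CompactSpace U] [MeasurableSpace U] [BorelSpace U]
  [MeasurableSpace W] {μ ν : Measure W} [IsProbabilityMeasure μ] [IsProbabilityMeasure ν]
  {c : X → U → ℝ} {M : ℝ} (hcM : ∀ x u, |c x u| ≤ M)
  (hc : Continuous fun p : X × U => c p.1 p.2)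
  {f : X → U → W → X} (hf : Measurable fun p : (X × U) × W => f p.1.1 p.1.2 p.2)
  (hfc : ∀ w, Continuous fun p : X × U => f p.1 p.2 w)
  {β : ℝ} (hβ : β ∈ Set.Ioo (0 : ℝ) 1) {γ : X → U} (hγ : Measurable γ)
  (hopt : ∀ x, discCost β c (noiseKernel f hf ν) (stationary γ hγ) x =
    discValue β c (noiseKernel f hf ν) x)

include hcM hc hfc hβ hopt

/-- Loss of an optimal policy for `ν` under `μ`, through the value function of `ν`. -/
theorem discCost_sub_discValue_le_nominal (x : X) :
    discCost β c (noiseKernel f hf μ) (stationary γ hγ) x - discValue β c (noiseKernel f hf μ) x ≤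
      2 * β / (1 - β) *
        (noiseDisc (discValue β c (noiseKernel f hf ν)) f μ ν).toReal := by
  have : Nonempty U := ⟨γ x⟩
  have : Nonempty (Policy X U) := ⟨stationary γ hγ⟩
  obtain ⟨v, hv, hgap, -⟩ := exists_discValue_eq ν hcM hc hf hfc hβ
  have hvm := v.continuous.measurable
  have hvB : ∀ x, |v x| ≤ ‖v‖ := fun x => v.norm_coe_le_norm x
  rw [funext hv]
  set D := (noiseDisc v f μ ν).toReal
  have hD := fun p => abs_le.1
    (abs_bellmanGap_sub_le (μ := μ) (ν := ν) hf (c := c) hvm hvB hβ.1.le p)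
  have hz : ∀ y, bellmanGap β c (noiseKernel f hf ν) v (y, γ y) = 0 := fun y =>
    bellmanGap_stationary_eq_zero hβ hc.measurable hcM hvm hvB hgap hγ y ((hopt y).trans (hv y))
  have h1 := discCost_le (T := noiseKernel f hf μ) hβ hc.measurable hcM hvm hvB (stationary γ hγ) x
    (stationary_ae_of_forall hγ (P := fun p => bellmanGap β c (noiseKernel f hf μ) v p ≤ β * D)
      (fun y => by have := (hD (y, γ y)).2; rw [hz] at this; linarith) x)
  have h2 := le_discValue (T := noiseKernel f hf μ) hβ hc.measurable hcM hvm hvB (a := -(β * D))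
    (fun p => by have := (hD p).1; have := hgap p; linarith) x
  have h3 : 2 * β / (1 - β) * D = β * D / (1 - β) - -(β * D) / (1 - β) := by ring
  linarith

/-- Loss of an optimal policy for `ν` under `μ`, through the value function of `μ`. -/
theorem discCost_sub_discValue_le_true (x : X) :
    discCost β c (noiseKernel f hf μ) (stationary γ hγ) x - discValue β c (noiseKernel f hf μ) x ≤
      2 * β / (1 - β) ^ 2 *
        (noiseDisc (discValue β c (noiseKernel f hf μ)) f μ ν).toReal := by
  have : Nonempty U := ⟨γ x⟩
  have : Nonempty (Policy X U) := ⟨stationary γ hγ⟩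
  have h1β : 0 < 1 - β := sub_pos.2 hβ.2
  obtain ⟨v, hv, hgap, -⟩ := exists_discValue_eq ν hcM hc hf hfc hβ
  obtain ⟨v', hv', hgap', hmin'⟩ := exists_discValue_eq μ hcM hc hf hfc hβ
  have hvm := v.continuous.measurable
  have hvB : ∀ x, |v x| ≤ ‖v‖ := fun x => v.norm_coe_le_norm x
  have hvm' := v'.continuous.measurable
  have hvB' : ∀ x, |v' x| ≤ ‖v'‖ := fun x => v'.norm_coe_le_norm x
  rw [funext hv']
  set D := (noiseDisc v' f μ ν).toReal
  have hD := fun p => abs_le.1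
    (abs_bellmanGap_sub_le (μ := μ) (ν := ν) hf (c := c) hvm' hvB' hβ.1.le p)
  have hz : ∀ y, bellmanGap β c (noiseKernel f hf ν) v (y, γ y) = 0 := fun y =>
    bellmanGap_stationary_eq_zero hβ hc.measurable hcM hvm hvB hgap hγ y ((hopt y).trans (hv y))
  set e := β * D / (1 - β) with he
  -- Actions with zero defect under `μ` have defect at most `β * D` under `ν`.
  have hup : ∀ y, v y ≤ v' y + e := fun y => by
    rw [← hv y]
    refine discValue_le (T := noiseKernel f hf ν) hβ hc.measurable hcM hvm' hvB' (fun ε hε =>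
      exists_measurable_selector_le (continuous_bellmanGap ν hf hc hfc β v') hε fun y => ?_) y
    obtain ⟨u, hu⟩ := hmin' y
    exact ⟨u, by have := (hD (y, u)).1; rw [hu] at this; linarith⟩
  have hlow : ∀ y, v' y - e ≤ v y := fun y => by
    have := le_discValue (T := noiseKernel f hf ν) hβ hc.measurable hcM hvm' hvB' (a := -(β * D))
      (fun p => by have := (hD p).2; have := hgap' p; linarith) y
    rw [hv, neg_div] at this
    linarith
  have hdist : dist v' v ≤ e := by
    have : Nonempty X := ⟨x⟩
    refine BoundedContinuousFunction.dist_le_iff_of_nonempty.2 fun y => ?_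
    rw [Real.dist_eq, abs_le]
    exact ⟨by linarith [hup y], by linarith [hlow y]⟩
  -- By `hz`, `c = v - β ∫ v dν` along `γ`. The defect thus splits into `v - v'`, the change of law
  -- for `v'`, and `β ∫ (v' - v) dν`, which give the three summands in this order.
  have hg : ∀ y, bellmanGap β c (noiseKernel f hf μ) v' (y, γ y) ≤ e + β * D + β * e := fun y => by
    have h1 := hz y
    have h2 := (hD (y, γ y)).2
    have h3 := mul_le_mul_of_nonneg_left ((abs_le.1
      (abs_integral_noise_sub_le ν hf v' v y (γ y))).2.trans hdist) hβ.1.le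
    have h4 := hup y
    rw [bellmanGap_noiseKernel hf ν hvm] at h1
    rw [bellmanGap_noiseKernel hf ν hvm'] at h2
    dsimp only at h1 h2
    linarith
  have h1 := discCost_le (T := noiseKernel f hf μ) hβ hc.measurable hcM hvm' hvB'
    (stationary γ hγ) x (stationary_ae_of_forall hγ
      (P := fun p => bellmanGap β c (noiseKernel f hf μ) v' p ≤ e + β * D + β * e) hg x)
  -- As `β * D = (1 - β) * e`, the numerator is `2 * e`.
  have h3 : 2 * β / (1 - β) ^ 2 * D = (e + β * D + β * e) / (1 - β) := by
    rw [he]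
    field_simp
    ring
  rw [h3]
  linarith

end Discounted

/-! ### Vanishing discount and the average-cost bound. -/

section Average

variable {X U W : Type*} [MetricSpace X] [MeasurableSpace X] [BorelSpace X]
  [MeasurableSpace U] [MeasurableSpace W] {μ : Measure W} [IsProbabilityMeasure μ]
  {c : X → U → ℝ} {f : X → U → W → X}
  (hf : Measurable fun p : (X × U) × W => f p.1.1 p.1.2 p.2)
  {Kc L : ℝ≥0} (hL : L < 1) (hcL : ∀ u, LipschitzWith Kc fun x => c x u)
  (hfL : ∀ u w, LipschitzWith L fun x => f x u w)

include hL hcL hfL in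
/-- Solutions of the discounted Bellman equation are Lipschitz, uniformly in the discount factor. -/
lemma sub_le_of_bellman {β : ℝ} (hβ : β ∈ Set.Ioo (0 : ℝ) 1) {v : X →ᵇ ℝ}
    (hgap : ∀ p, 0 ≤ bellmanGap β c (noiseKernel f hf μ) v p)
    (hmin : ∀ x, ∃ u, bellmanGap β c (noiseKernel f hf μ) v (x, u) = 0) (x y : X) :
    v x - v y ≤ Kc / (1 - L) * dist x y := by
  have hL' : (L : ℝ) < 1 := by exact_mod_cast hL
  have hL1 : 0 < 1 - (L : ℝ) := sub_pos.2 hL'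
  set C : ℝ := Kc / (1 - L) with hC
  have hC0 : 0 ≤ C := div_nonneg Kc.2 hL1.le
  -- `C` is the Lipschitz constant that a Bellman step reproduces: the cost adds `Kc` and the
  -- dynamics multiply by `L`.
  have hCeq : Kc + L * C = C := by
    rw [hC]
    field_simp
    ring
  -- No Lipschitz bound on `v` is known at the start, so the trivial oscillation bound is carried as
  -- slack; each Bellman step shrinks it by `β`.
  have key : ∀ n : ℕ, ∀ x y, v x - v y ≤ C * dist x y + β ^ n * (2 * ‖v‖) := by
    intro n
    induction n with
    | zero =>
      intro x y
      have h1 := (abs_le.1 (v.norm_coe_le_norm x)).2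
      have h2 := (abs_le.1 (v.norm_coe_le_norm y)).1
      have h3 : 0 ≤ C * dist x y := mul_nonneg hC0 dist_nonneg
      simp only [pow_zero, one_mul]
      linarith
    | succ n ih =>
      intro x y
      -- The optimal action at `y` is a competitor at `x`.
      obtain ⟨u, hu⟩ := hmin y
      have hx := hgap (x, u)
      rw [bellmanGap_noiseKernel hf μ v.continuous.measurable] at hu hx
      dsimp only at hu hx
      have h1 : (∫ w, v (f x u w) ∂μ) - ∫ w, v (f y u w) ∂μ ≤
          C * (L * dist x y) + β ^ n * (2 * ‖v‖) := by
        rw [← integral_sub (integrable_noise μ hf v x u) (integrable_noise μ hf v y u)]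
        refine (integral_mono ((integrable_noise μ hf v x u).sub (integrable_noise μ hf v y u))
          (integrable_const (C * (L * dist x y) + β ^ n * (2 * ‖v‖))) fun w => ?_).trans
          (by simp)
        refine (ih _ _).trans ?_
        gcongr
        exact (hfL u w).dist_le_mul x y
      have h2 : c x u - c y u ≤ Kc * dist x y :=
        (le_abs_self _).trans ((hcL u).dist_le_mul x y)
      have h3 := mul_le_mul_of_nonneg_left h1 hβ.1.le
      have h4 : β * (C * (L * dist x y)) ≤ C * (L * dist x y) :=
        mul_le_of_le_one_left (by positivity) hβ.2.le
      have h5 : C * dist x y = Kc * dist x y + C * (L * dist x y) := by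
        nth_rw 1 [← hCeq]
        ring
      rw [h5, pow_succ]
      linarith
  have hlim : Tendsto (fun n : ℕ => C * dist x y + β ^ n * (2 * ‖v‖)) atTop
      (𝓝 (C * dist x y + 0 * (2 * ‖v‖))) :=
    ((tendsto_pow_atTop_nhds_zero_of_lt_one hβ.1.le hβ.2).mul_const _).const_add _
  simpa using ge_of_tendsto' hlim fun n => key n x y

variable [CompactSpace X] [MetricSpace U] [CompactSpace U] [BorelSpace U] {M : ℝ}
  (hcM : ∀ x u, |c x u| ≤ M) (hc : Continuous fun p : X × U => c p.1 p.2)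
  (hfc : ∀ w, Continuous fun p : X × U => f p.1 p.2 w)

include hL hcL hfL hcM hc hfc in
/-- A relative value function obtained by vanishing discounting is continuous and solves the
average cost optimality equation. -/
theorem exists_average_cost_optimality [Nonempty U] {h : X → ℝ}
    (hh : IsVanishingDiscountLimit c (noiseKernel f hf μ) h) :
    ∃ (h' : X →ᵇ ℝ) (g : ℝ), h = h' ∧ (∀ p, g ≤ bellmanGap 1 c (noiseKernel f hf μ) h' p) ∧
      ∀ x, ∃ u, bellmanGap 1 c (noiseKernel f hf μ) h' (x, u) ≤ g := by
  obtain ⟨z, b, -, hb, hb1, hlim⟩ := hh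
  have : Nonempty (Policy X U) :=
    ⟨stationary (fun _ => Classical.arbitrary U) measurable_const⟩
  choose v hv hgap hmin using fun n => exists_discValue_eq μ hcM hc hf hfc (hb n)
  simp_rw [hv] at hlim
  set C : ℝ := Kc / (1 - L)
  have hlip : ∀ n x y, |v n x - v n y| ≤ C * dist x y := fun n x y => by
    have h1 := sub_le_of_bellman hf hL hcL hfL (hb n) (hgap n) (hmin n) x y
    have h2 := sub_le_of_bellman hf hL hcL hfL (hb n) (hgap n) (hmin n) y x
    rw [dist_comm] at h2
    rw [abs_le]
    constructor <;> linarith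
  have hhlip : ∀ x y, dist (h x) (h y) ≤ C * dist x y := fun x y => by
    refine le_of_tendsto (((hlim x).sub (hlim y)).abs) (Eventually.of_forall fun n => ?_)
    simpa using hlip n x y
  have hhc : Continuous h := (LipschitzWith.of_dist_le' hhlip).continuous
  have hbd : ∀ n, (1 - b n) * v n z ∈ Set.Icc (-M) M := fun n => by
    have h1 : 0 < 1 - b n := sub_pos.2 (hb n).2
    have h2 := abs_discValue_le (T := noiseKernel f hf μ) (hb n) hc.measurable hcM z
    rw [hv, le_div_iff₀ h1, ← abs_of_pos h1, ← abs_mul, mul_comm] at h2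
    exact abs_le.1 h2
  obtain ⟨g, -, φ, hφ, hg⟩ := isCompact_Icc.tendsto_subseq hbd
  refine ⟨BoundedContinuousFunction.mkOfCompact ⟨h, hhc⟩, g, rfl, ?_⟩
  rw [show ⇑(BoundedContinuousFunction.mkOfCompact ⟨h, hhc⟩) = h from rfl]
  -- The discounted defect of `v n` equals that of `v n - v n z` minus `(1 - b n) * v n z`. The
  -- former has a limit involving `h`, the latter tends to `g` along `φ`. The actions may vary, so
  -- that the case of minimizers is covered.
  have key : ∀ (x : X) (ψ : ℕ → ℕ) (u' : ℕ → U) (u : U), Tendsto ψ atTop atTop →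
      Tendsto u' atTop (𝓝 u) → Tendsto (fun n => bellmanGap (b (φ (ψ n))) c (noiseKernel f hf μ)
        (v (φ (ψ n))) (x, u' n)) atTop (𝓝 (bellmanGap 1 c (noiseKernel f hf μ) h (x, u) - g)) := by
    intro x ψ u' u hψ hu
    have hφψ : Tendsto (fun n => φ (ψ n)) atTop atTop := hφ.tendsto_atTop.comp hψ
    have hint : Tendsto (fun n => ∫ w, (v (φ (ψ n)) (f x (u' n) w) - v (φ (ψ n)) z) ∂μ) atTop
        (𝓝 (∫ w, h (f x u w) ∂μ)) := by
      refine tendsto_integral_of_dominated_convergence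
        (fun _ => C * Metric.diam (Set.univ : Set X)) (fun n => ?_) (integrable_const _)
        (fun n => ae_of_all _ fun w => ?_) (ae_of_all _ fun w => ?_)
      · exact ((integrable_noise μ hf _ x _).sub (integrable_const _)).aestronglyMeasurable
      · refine (hlip _ _ _).trans (mul_le_mul_of_nonneg_left ?_ ?_)
        · exact Metric.dist_le_diam_of_mem isCompact_univ.isBounded trivial trivial
        · exact div_nonneg Kc.2 (sub_nonneg.2 (by exact_mod_cast hL.le))
      · have h1 := (hlim (f x u w)).comp hφψ
        -- Pointwise convergence is not enough at moving points; the uniform Lipschitz bound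
        -- supplies the equicontinuity.
        have h2 : Tendsto (fun n => v (φ (ψ n)) (f x (u' n) w) - v (φ (ψ n)) (f x u w)) atTop
            (𝓝 0) := by
          refine squeeze_zero_norm (fun n => hlip _ _ _) ?_
          have h3 : Tendsto (fun n => f x (u' n) w) atTop (𝓝 (f x u w)) :=
            ((hfc w).tendsto (x, u)).comp (tendsto_const_nhds.prodMk_nhds hu)
          simpa using (tendsto_iff_dist_tendsto_zero.1 h3).const_mul C
        have h4 := h2.add h1
        rw [zero_add] at h4
        refine h4.congr fun n => ?_
        simp only [Function.comp_apply]
        ring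
    have hcu : Tendsto (fun n => c x (u' n)) atTop (𝓝 (c x u)) :=
      (hc.tendsto (x, u)).comp (tendsto_const_nhds.prodMk_nhds hu)
    have hbt := hb1.comp hφψ
    have hall := ((hcu.add (hbt.mul hint)).sub ((hlim x).comp hφψ)).sub (hg.comp hψ)
    rw [bellmanGap_noiseKernel hf μ hhc.measurable]
    refine hall.congr fun n => ?_
    rw [bellmanGap_noiseKernel hf μ (v _).continuous.measurable,
      integral_sub (integrable_noise μ hf _ x _) (integrable_const _)]
    simp only [Function.comp_apply, integral_const, probReal_univ, one_smul]
    ring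
  refine ⟨fun p => ?_, fun x => ?_⟩
  · have h1 := key p.1 id (fun _ => p.2) p.2 tendsto_id tendsto_const_nhds
    exact sub_nonneg.1 (ge_of_tendsto' h1 fun n => hgap _ _)
  -- The discounted minimizers vary with `n`; a limit point in the compact action space attains the
  -- limiting infimum.
  · choose u' hu' using fun n => hmin (φ n) x
    obtain ⟨u, ψ, hψ, hu⟩ := CompactSpace.tendsto_subseq u'
    have h1 := key x ψ (fun n => u' (ψ n)) u hψ.tendsto_atTop hu
    exact ⟨u, sub_nonpos.1 (le_of_tendsto' h1 fun n => (hu' (ψ n)).le)⟩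

include hL hcL hfL hcM hc hfc in
theorem avgCost_sub_avgValue_le {ν : Measure W} [IsProbabilityMeasure ν] {hμ hν : X → ℝ}
    (hhμ : IsVanishingDiscountLimit c (noiseKernel f hf μ) hμ)
    (hhν : IsVanishingDiscountLimit c (noiseKernel f hf ν) hν)
    {γ : X → U} (hγ : Measurable γ) (hatt : AttainsACOE c (noiseKernel f hf ν) hν γ) (x : X) :
    avgCost c (noiseKernel f hf μ) (stationary γ hγ) x - avgValue c (noiseKernel f hf μ) x ≤
      (noiseDisc hμ f μ ν).toReal + (noiseDisc hν f μ ν).toReal := by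
  have : Nonempty U := ⟨γ x⟩
  have : Nonempty (Policy X U) := ⟨stationary γ hγ⟩
  obtain ⟨v, g, rfl, hgap, hmin⟩ := exists_average_cost_optimality hf hL hcL hfL hcM hc hfc hhμ
  obtain ⟨v', g', rfl, hgap', hmin'⟩ := exists_average_cost_optimality hf hL hcL hfL hcM hc hfc hhν
  have hvm := v.continuous.measurable
  have hvB : ∀ x, |v x| ≤ ‖v‖ := fun x => v.norm_coe_le_norm x
  have hvm' := v'.continuous.measurable
  have hvB' : ∀ x, |v' x| ≤ ‖v'‖ := fun x => v'.norm_coe_le_norm x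
  have hD := fun p => abs_le.1
    (abs_bellmanGap_sub_le (μ := μ) (ν := ν) hf (c := c) hvm hvB zero_le_one p)
  have hD' := fun p => abs_le.1
    (abs_bellmanGap_sub_le (μ := μ) (ν := ν) hf (c := c) hvm' hvB' zero_le_one p)
  simp only [one_mul] at hD hD'
  have h1 : avgCost c (noiseKernel f hf μ) (stationary γ hγ) x ≤
      g' + (noiseDisc v' f μ ν).toReal := by
    refine avgCost_le hc.measurable hcM hvm' hvB' _ x (stationary_ae_of_forall hγ
      (P := fun p => bellmanGap 1 c (noiseKernel f hf μ) v' p ≤ _) (fun y => ?_) x)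
    -- Some action has defect at most `g'` under `ν`, hence so does the minimizing action `γ y`.
    obtain ⟨u, hu⟩ := hmin' y
    have ha := hatt y u
    have := (hD' (y, γ y)).2
    simp only [bellmanGap, one_mul] at this hu ⊢
    linarith
  have h2 : g ≤ avgValue c (noiseKernel f hf μ) x :=
    le_ciInf fun π => le_avgCost hc.measurable hcM hvm hvB π x fun t => ae_of_all _ hgap
  -- The average cost under `ν` of a near-minimizer `γ'` for the `μ` equation lies between the two
  -- sides, up to `ε`.
  have h3 : g' ≤ g + (noiseDisc v f μ ν).toReal := by
    refine le_of_forall_pos_le_add fun ε hε => ?_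
    obtain ⟨γ', hγ', hsel⟩ := exists_measurable_selector_le
      (continuous_bellmanGap μ hf hc hfc 1 v) hε hmin
    refine (le_avgCost (T := noiseKernel f hf ν) hc.measurable hcM hvm' hvB' (stationary γ' hγ') x
      fun t => ae_of_all _ hgap').trans ?_
    refine avgCost_le hc.measurable hcM hvm hvB _ x (stationary_ae_of_forall hγ'
      (P := fun p => bellmanGap 1 c (noiseKernel f hf ν) v p ≤ _) (fun y => ?_) x)
    have := (hD (y, γ' y)).1
    have := hsel y
    linarith
  linarith

include hL hcL hfL hcM hc hfc in
lemma noiseDisc_vanishingDiscountLimit_ne_top [Nonempty U] (ν₁ ν₂ : Measure W)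
    [IsProbabilityMeasure ν₁] [IsProbabilityMeasure ν₂] {h : X → ℝ}
    (hh : IsVanishingDiscountLimit c (noiseKernel f hf μ) h) : noiseDisc h f ν₁ ν₂ ≠ ∞ := by
  obtain ⟨v, g, rfl, -⟩ := exists_average_cost_optimality hf hL hcL hfL hcM hc hfc hh
  exact noiseDisc_ne_top fun x => v.norm_coe_le_norm x

end Average

end MDP

/-! ### From pointwise real bounds to the supremum norm. -/

theorem mainTheorem9 {X U W : Type*}
    [MetricSpace X] [CompleteSpace X] [SecondCountableTopology X]
    [MeasurableSpace X] [BorelSpace X]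
    [MetricSpace U] [CompactSpace U] [MeasurableSpace U] [BorelSpace U]
    [MeasurableSpace W] (μ ν : Measure W) [IsProbabilityMeasure μ] [IsProbabilityMeasure ν]
    (c : X → U → ℝ) (hc_nonneg : ∀ x u, 0 ≤ c x u) (hc_bdd : ∃ M, ∀ x u, c x u ≤ M)
    (hc_cont : Continuous fun p : X × U => c p.1 p.2)
    (f : X → U → W → X) (hf : Measurable fun p : (X × U) × W => f p.1.1 p.1.2 p.2)
    (hf_cont : ∀ w, Continuous fun p : X × U => f p.1 p.2 w) :
    -- discounted cost: `γ` is optimal for the noise law `ν`, and is applied under `μ`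
    (∀ (β : ℝ), β ∈ Set.Ioo (0 : ℝ) 1 → ∀ (γ : X → U) (hγ : Measurable γ),
      (∀ x, MDP.discCost β c (MDP.noiseKernel f hf ν) (MDP.stationary γ hγ) x =
        MDP.discValue β c (MDP.noiseKernel f hf ν) x) →
      MDP.supNorm (fun x =>
          MDP.discCost β c (MDP.noiseKernel f hf μ) (MDP.stationary γ hγ) x -
            MDP.discValue β c (MDP.noiseKernel f hf μ) x) ≤
        ENNReal.ofReal (2 * β / (1 - β)) *
          MDP.noiseDisc (MDP.discValue β c (MDP.noiseKernel f hf ν)) f μ ν ∧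
      MDP.supNorm (fun x =>
          MDP.discCost β c (MDP.noiseKernel f hf μ) (MDP.stationary γ hγ) x -
            MDP.discValue β c (MDP.noiseKernel f hf μ) x) ≤
        ENNReal.ofReal (2 * β / (1 - β) ^ 2) *
          MDP.noiseDisc (MDP.discValue β c (MDP.noiseKernel f hf μ)) f μ ν) ∧
    -- average cost: `γ` is the canonical optimal policy for `ν`, and is applied under `μ`
    (CompactSpace X → ∀ (Kc L K : ℝ≥0), L < 1 →
      (∀ u, LipschitzWith Kc fun x => c x u) →
      (∀ u w, LipschitzWith L fun x => f x u w) →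
      (∀ x y u u' w, dist (f x u w) (f y u' w) ≤ K * (dist x y + dist u u')) →
      ∀ (hμ hν : X → ℝ),
      MDP.IsVanishingDiscountLimit c (MDP.noiseKernel f hf μ) hμ →
      MDP.IsVanishingDiscountLimit c (MDP.noiseKernel f hf ν) hν →
      ∀ (γ : X → U) (hγ : Measurable γ),
      MDP.AttainsACOE c (MDP.noiseKernel f hf ν) hν γ →
      MDP.VanishingDiscountCondition c (MDP.noiseKernel f hf μ) (MDP.stationary γ hγ) →
      MDP.supNorm (fun x =>
          MDP.avgCost c (MDP.noiseKernel f hf μ) (MDP.stationary γ hγ) x -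
            MDP.avgValue c (MDP.noiseKernel f hf μ) x) ≤
        MDP.noiseDisc hμ f μ ν + MDP.noiseDisc hν f μ ν) := by
  obtain ⟨M, hM⟩ := hc_bdd
  have hcM : ∀ x u, |c x u| ≤ M := fun x u => by
    rw [abs_of_nonneg (hc_nonneg x u)]
    exact hM x u
  refine ⟨fun β hβ γ hγ hopt => ?_, fun _ Kc L _ hL hcL hfL _ hμ hν hhμ hhν γ hγ hatt _ => ?_⟩
  · have h1β : 0 < 1 - β := sub_pos.2 hβ.2
    have htop : ∀ (lam : Measure W) [IsProbabilityMeasure lam] (x : X),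
        MDP.noiseDisc (MDP.discValue β c (MDP.noiseKernel f hf lam)) f μ ν ≠ ∞ := fun lam _ x => by
      have : Nonempty (MDP.Policy X U) := ⟨MDP.stationary γ hγ⟩
      exact MDP.noiseDisc_ne_top fun y =>
        MDP.abs_discValue_le (T := MDP.noiseKernel f hf lam) hβ hc_cont.measurable hcM y
    constructor <;> refine MDP.supNorm_le_iff.2 fun x => ?_
    · rw [abs_of_nonneg (sub_nonneg.2 (MDP.discValue_le_discCost hβ hc_cont.measurable hcM _ x)),
        ← ENNReal.ofReal_toReal (htop ν x), ← ENNReal.ofReal_mul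
          (div_nonneg (mul_nonneg zero_le_two hβ.1.le) h1β.le)]
      exact ENNReal.ofReal_le_ofReal
        (MDP.discCost_sub_discValue_le_nominal hcM hc_cont hf hf_cont hβ hγ hopt x)
    · rw [abs_of_nonneg (sub_nonneg.2 (MDP.discValue_le_discCost hβ hc_cont.measurable hcM _ x)),
        ← ENNReal.ofReal_toReal (htop μ x), ← ENNReal.ofReal_mul
          (div_nonneg (mul_nonneg zero_le_two hβ.1.le) (sq_nonneg _))]
      exact ENNReal.ofReal_le_ofReal
        (MDP.discCost_sub_discValue_le_true hcM hc_cont hf hf_cont hβ hγ hopt x)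
  · refine MDP.supNorm_le_iff.2 fun x => ?_
    have : Nonempty U := ⟨γ x⟩
    have h1 := MDP.noiseDisc_vanishingDiscountLimit_ne_top hf hL hcL hfL hcM hc_cont hf_cont μ ν hhμ
    have h2 := MDP.noiseDisc_vanishingDiscountLimit_ne_top hf hL hcL hfL hcM hc_cont hf_cont μ ν hhν
    rw [abs_of_nonneg (sub_nonneg.2 (MDP.avgValue_le_avgCost hcM _ x)),
      ← ENNReal.ofReal_toReal h1, ← ENNReal.ofReal_toReal h2,
      ← ENNReal.ofReal_add ENNReal.toReal_nonneg ENNReal.toReal_nonneg]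
    exact ENNReal.ofReal_le_ofReal
      (MDP.avgCost_sub_avgValue_le hf hL hcL hfL hcM hc_cont hf_cont hhμ hhν hγ hatt x)
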